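/- Let $\mathbb X,\mathbb A,\mathbb W$ be complete separable metric spaces with their Borel $\sigma$-fields, $\mathbb A\neq\varnothing$. Let $\mathcal P(\mathbb A),\mathcal P(\mathbb W)$ be the sets of Borel probability measures on $\mathbb A,\mathbb W$ with the topology of weak convergence, and let $\mathcal Q\subset\mathcal P(\mathbb A)$ and $\varnothing\ne\mathcal P\subset\mathcal P(\mathbb W)$ be Borel subsets with $\delta_a\in\mathcal Q$ for every $a\in\mathbb A$. Let $f:\mathbb X\times\mathbb A\times\mathbb W\to\mathbb X$ and $r:\mathbb X\times\mathbb A\to\mathbb R$ be uniformly continuous, with $0\le r\le r_\vee$ for a constant $r_\vee$, and let $\alpha\in(0,1)$. *Policies.* Put $h_t=(x_0,a_0,\dots,a_{t-1},x_t)$ and $g_t=(h_t,a_t)$. A controller policy $\pi=(\pi_t)_{t\ge0}$ is a sequence of measurable maps $h_t\mapsto\pi_t(da|h_t)\in\mathcal P(\mathbb A)$; a (current-action-aware, CAA) adversary policy $\gamma=(\gamma_t)_{t\ge0}$ is a sequence of measurable maps $g_t\mapsto\gamma_t(dw|g_t)\in\mathcal P(\mathbb W)$. Let $\Pi_{\mathrm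 H}(\mathcal Q)$ be the set of controller policies with $\pi_t(\cdot|h_t)\in\mathcal Q$ for all $t,h_t$; let $\Pi_{\mathrm M}(\mathcal Q)$ be the set of those for which $\pi_t(\cdot|h_t)$ depends on $h_t$ only through $x_t$ (Markov), and $\Pi_{\mathrm S}(\mathcal Q)$ the set of those for which moreover the dependence on $x_t$ is the same for all $t$ (stationary). Similarly, let $\Gamma_{\mathrm H}(\mathcal P)$ be the set of adversary policies with $\gamma_t(\cdot|g_t)\in\mathcal P$ for all $t,g_t$, and let $\Gamma_{\mathrm M}(\mathcal P)$, $\Gamma_{\mathrm S}(\mathcal P)$ be the sets of those for which $\gamma_t(\cdot|g_t)$ depends on $g_t$ only through $(x_t,a_t)$, respectively moreover in the same way for all $t$. *Values.* For $x\in\mathbb X$ and policies $\pi,\gamma$, let $E_x^{\pi,\gamma}$ be the expectation under the unique law of $(A_0,W_0,A_1,W_1,\dots)$ for which, with $X_0=x$, $X_{t+1}=f(X_t,A_t,W_t)$, $H_t=(X_0,A_0,\dots,A_{t-1},X_t)$, the conditional law of $A_t$ given the past $(A_0,W_0,\dots,A_{t-1},W_{t-1})$ is $\pi_t(da|H_t)$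 and that of $W_t$ given this past and $A_t$ is $\gamma_t(dw|H_t,A_t)$. For a set $\Pi$ of controller policies and a set $\Gamma$ of adversary policies, the distributionally robust stochastic control (DRSC) value is $$v^*(x,\Pi,\Gamma)=\sup_{\pi\in\Pi}\inf_{\gamma\in\Gamma}E_x^{\pi,\gamma}\sum_{t=0}^\infty\alpha^t r(X_t,A_t).$$ **Theorem.** For every bounded continuous $u:\mathbb X\to\mathbb R$ and every $x\in\mathbb X$, $$\sup_{\phi\in\mathcal Q}\int_{\mathbb A}\Big(r(x,a)+\alpha\inf_{\psi\in\mathcal P}\int_{\mathbb W}u(f(x,a,w))\,\psi(dw)\Big)\phi(da)=\sup_{a\in\mathbb A}\Big(r(x,a)+\alpha\inf_{\psi\in\mathcal P}\int_{\mathbb W}u(f(x,a,w))\,\psi(dw)\Big)=:\mathcal T(u)(x).$$ The CAA Bellman equation $u=\mathcal T(u)$ has exactly one bounded continuous solution $u^*$; it is uniformly continuous. Moreover, $u^*(x)=v^*(x,\Pi,\Gamma)$ for all $x\in\mathbb X$ and for each of the 9 pairings of $\Pi\in\{\Pi_{\mathrm H}(\mathcal Q),\Pi_{\mathrm M}(\mathcal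 Q),\Pi_{\mathrm S}(\mathcal Q)\}$ with $\Gamma\in\{\Gamma_{\mathrm H}(\mathcal P),\Gamma_{\mathrm M}(\mathcal P),\Gamma_{\mathrm S}(\mathcal P)\}$. -/

import Mathlib

open MeasureTheory ProbabilityTheory
open scoped BoundedContinuousFunction

namespace DRSC

/-- The controller's histories `h_t = (x_0, a_0, …, a_{t-1}, x_t)`, stored as the pair of
`(x_0, …, x_t)` and `(a_0, …, a_{t-1})`. The adversary's histories are `g_t = (h_t, a_t)`, that is,
the elements of `Hist X A t × A`. -/
abbrev Hist (X A : Type*) (t : ℕ) : Type _ := (Fin (t + 1) → X) × (Fin t → A)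

/-- The current state `x_t` of a history `h_t`. -/
def Hist.current {X A : Type*} {t : ℕ} (h : Hist X A t) : X := h.1 (Fin.last t)

/-- A controller's policy `π = (π_0, π_1, …)`: measurable decisions `π_t(da | h_t)`. -/
structure ControlPolicy (X A : Type*) [MeasurableSpace X] [MeasurableSpace A] where
  decision : ∀ t : ℕ, Kernel (Hist X A t) A
  isMarkovKernel : ∀ t : ℕ, IsMarkovKernel (decision t)

attribute [instance] ControlPolicy.isMarkovKernel

/-- An adversary's (current-action-aware) policy `γ = (γ_0, γ_1, …)`: measurable decisions
`γ_t(dw | g_t)`, where `g_t = (h_t, a_t)`. -/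
structure AdversaryPolicy (X A W : Type*) [MeasurableSpace X] [MeasurableSpace A]
    [MeasurableSpace W] where
  decision : ∀ t : ℕ, Kernel (Hist X A t × A) W
  isMarkovKernel : ∀ t : ℕ, IsMarkovKernel (decision t)

attribute [instance] AdversaryPolicy.isMarkovKernel

/-- The information structures: history-dependent, Markov, stationary (time-homogeneous) Markov. -/
inductive Info where
  | H
  | M
  | S

section Policies

variable {X A W : Type*} [MeasurableSpace X] [MeasurableSpace A] [MeasurableSpace W]

/-- `π_t(da | h_t)` as a probability measure. -/
def ControlPolicy.law (π : ControlPolicy X A) (t : ℕ) (h : Hist X A t) : ProbabilityMeasure A :=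
  ⟨π.decision t h, inferInstance⟩

/-- `γ_t(dw | g_t)` as a probability measure. -/
def AdversaryPolicy.law (γ : AdversaryPolicy X A W) (t : ℕ) (g : Hist X A t × A) :
    ProbabilityMeasure W :=
  ⟨γ.decision t g, inferInstance⟩

/-- The decision at each time depends on the history through the current state only. -/
def ControlPolicy.IsMarkov (π : ControlPolicy X A) : Prop :=
  ∀ (t : ℕ) (h h' : Hist X A t), h.current = h'.current → π.law t h = π.law t h'

/-- Markov, and the same decision rule is used at all times. -/
def ControlPolicy.IsStationary (π : ControlPolicy X A) : Prop :=
  ∀ (t s : ℕ) (h : Hist X A t) (h' : Hist X A s), h.current = h'.current → π.law t h = π.law s h'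

/-- The decision at each time depends on the history through the current state and the current
action only. -/
def AdversaryPolicy.IsMarkov (γ : AdversaryPolicy X A W) : Prop :=
  ∀ (t : ℕ) (h h' : Hist X A t) (a : A), h.current = h'.current → γ.law t (h, a) = γ.law t (h', a)

/-- Markov, and the same decision rule is used at all times. -/
def AdversaryPolicy.IsStationary (γ : AdversaryPolicy X A W) : Prop :=
  ∀ (t s : ℕ) (h : Hist X A t) (h' : Hist X A s) (a : A), h.current = h'.current →
    γ.law t (h, a) = γ.law s (h', a)

variable (X) in
/-- The controller's policy classes `Π_H(Q)`, `Π_M(Q)`, `Π_S(Q)`. -/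
def controlClass (Q : Set (ProbabilityMeasure A)) : Info → Set (ControlPolicy X A)
  | .H => {π | ∀ t h, π.law t h ∈ Q}
  | .M => {π | (∀ t h, π.law t h ∈ Q) ∧ π.IsMarkov}
  | .S => {π | (∀ t h, π.law t h ∈ Q) ∧ π.IsStationary}

variable (X A) in
/-- The current-action-aware adversary's policy classes `Γ_H(P)`, `Γ_M(P)`, `Γ_S(P)`. -/
def adversaryClass (P : Set (ProbabilityMeasure W)) : Info → Set (AdversaryPolicy X A W)
  | .H => {γ | ∀ t g, γ.law t g ∈ P}
  | .M => {γ | (∀ t g, γ.law t g ∈ P) ∧ γ.IsMarkov}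
  | .S => {γ | (∀ t g, γ.law t g ∈ P) ∧ γ.IsStationary}

end Policies

section Dynamics

variable {X A W : Type*}

/-- The controlled state process started from `x`, along `ω = (a_0, w_0, a_1, w_1, …)`:
`X_0 = x` and `X_{t+1} = f (X_t, a_t, w_t)`. -/
def state (f : X × A × W → X) (x : X) (ω : ℕ → A × W) : ℕ → X
  | 0 => x
  | t + 1 => f (state f x ω t, (ω t).1, (ω t).2)

/-- The history `H_t = (X_0, A_0, …, A_{t-1}, X_t)` along `ω`. -/
def history (f : X × A × W → X) (x : X) (t : ℕ) (ω : ℕ → A × W) : Hist X A t :=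
  (fun k => state f x ω k, fun k => (ω k).1)

/-- A sequence that extends `(a_0, w_0, …, a_n, w_n)`. Only its first `n + 1` terms matter below. -/
def extend {n : ℕ} (e : Finset.Iic n → A × W) : ℕ → A × W :=
  fun k => e ⟨min k n, Finset.mem_Iic.2 (min_le_right k n)⟩

variable [MeasurableSpace X] [MeasurableSpace A] [MeasurableSpace W]

theorem measurable_state {f : X × A × W → X} (hf : Measurable f) (x : X) (t : ℕ) :
    Measurable (fun ω : ℕ → A × W => state f x ω t) := by
  induction t with
  | zero => exact measurable_const
  | succ t ih =>
    exact hf.comp (ih.prodMk ((measurable_pi_apply t).fst.prodMk (measurable_pi_apply t).snd))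

theorem measurable_history {f : X × A × W → X} (hf : Measurable f) (x : X) (t : ℕ) :
    Measurable (history f x t : (ℕ → A × W) → Hist X A t) :=
  Measurable.prodMk
    (measurable_pi_lambda (fun ω (k : Fin (t + 1)) => state f x ω k) fun k =>
      measurable_state hf x k)
    (measurable_pi_lambda (fun (ω : ℕ → A × W) (k : Fin t) => (ω k).1) fun k =>
      (measurable_pi_apply (k : ℕ)).fst)

theorem measurable_extend {n : ℕ} :
    Measurable (extend : (Finset.Iic n → A × W) → ℕ → A × W) :=
  measurable_pi_lambda _ fun _ => measurable_pi_apply _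

/-- The conditional law of `(A_{n+1}, W_{n+1})` given `(a_0, w_0, …, a_n, w_n)`:
`γ_{n+1}(dw | h_{n+1}, a) π_{n+1}(da | h_{n+1})`. -/
noncomputable def stepKernel {f : X × A × W → X} (hf : Measurable f) (x : X)
    (π : ControlPolicy X A) (γ : AdversaryPolicy X A W) (n : ℕ) :
    Kernel (Finset.Iic n → A × W) (A × W) :=
  (π.decision (n + 1) ⊗ₖ γ.decision (n + 1)).comap (fun e => history f x (n + 1) (extend e))
    ((measurable_history hf x (n + 1)).comp measurable_extend)

instance {f : X × A × W → X} (hf : Measurable f) (x : X)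
    (π : ControlPolicy X A) (γ : AdversaryPolicy X A W) (n : ℕ) :
    IsMarkovKernel (stepKernel hf x π γ n) := by
  unfold stepKernel; infer_instance

/-- The law `P_x^{π,γ}` of `(A_0, W_0, A_1, W_1, …)` when `X_0 = x`, given by the Ionescu-Tulcea
theorem: `(A_0, W_0)` has law `γ_0(dw | x, a) π_0(da | x)`, and the conditional laws of the
subsequent pairs are the `stepKernel`s. -/
noncomputable def pathMeasure {f : X × A × W → X} (hf : Measurable f) (x : X)
    (π : ControlPolicy X A) (γ : AdversaryPolicy X A W) : Measure (ℕ → A × W) :=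
  Kernel.trajMeasure (X := fun _ => A × W)
    ((π.decision 0 ⊗ₖ γ.decision 0) (fun _ => x, Fin.elim0)) (stepKernel hf x π γ)

/-- The expected discounted reward `E_x^{π,γ} ∑_{t ≥ 0} α^t r(X_t, A_t)`. -/
noncomputable def value {f : X × A × W → X} (hf : Measurable f) (r : X × A → ℝ) (α : ℝ)
    (π : ControlPolicy X A) (γ : AdversaryPolicy X A W) (x : X) : ℝ :=
  ∫ ω, ∑' t : ℕ, α ^ t * r (state f x ω t, (ω t).1) ∂(pathMeasure hf x π γ)

/-- The max-min value `v^*(x, Pi, Gam)`. -/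
noncomputable def maxminValue {f : X × A × W → X} (hf : Measurable f) (r : X × A → ℝ) (α : ℝ)
    (Pi : Set (ControlPolicy X A)) (Gam : Set (AdversaryPolicy X A W)) (x : X) : ℝ :=
  ⨆ π : Pi, ⨅ γ : Gam, value hf r α π.1 γ.1 x

/-- `r(x, a) + α inf_{ψ ∈ P} ∫ u(f(x, a, w)) ψ(dw)`. -/
noncomputable def robustQ (f : X × A × W → X) (r : X × A → ℝ) (α : ℝ)
    (P : Set (ProbabilityMeasure W)) (u : X → ℝ) (x : X) (a : A) : ℝ :=
  r (x, a) + α * ⨅ ψ : P, ∫ w, u (f (x, a, w)) ∂(ψ.1 : Measure W)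

/-- The current-action-aware Bellman operator
`T(u)(x) = sup_a { r(x, a) + α inf_{ψ ∈ P} ∫ u(f(x, a, w)) ψ(dw) }`. -/
noncomputable def bellman (f : X × A × W → X) (r : X × A → ℝ) (α : ℝ)
    (P : Set (ProbabilityMeasure W)) (u : X → ℝ) (x : X) : ℝ :=
  ⨆ a : A, robustQ f r α P u x a

/-- The same operator with randomized actions: the supremum over `φ ∈ Q` of
`∫ { r(x, a) + α inf_{ψ ∈ P} ∫ u(f(x, a, w)) ψ(dw) } φ(da)`. -/
noncomputable def bellmanRandomized (f : X × A × W → X) (r : X × A → ℝ) (α : ℝ)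
    (Q : Set (ProbabilityMeasure A)) (P : Set (ProbabilityMeasure W)) (u : X → ℝ) (x : X) : ℝ :=
  ⨆ φ : Q, ∫ a, robustQ f r α P u x a ∂(φ.1 : Measure A)

end Dynamics

end DRSC

namespace DRSC

set_option linter.unusedSectionVars false

/-! The Bellman operator contracts the sup distance by the factor `α`, because suprema, infima and
averages are all 1-Lipschitz for uniform distance. It preserves uniform continuity: the functions
under the supremum and infimum share one modulus. Banach's theorem on the closed set of bounded
uniformly continuous functions gives the solution `u`, and the contraction estimate alone gives
uniqueness among bounded continuous functions.

The value is identified by verification (`le_value`, `value_le`): a one-step Bellman inequality with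
error `ε` at every history telescopes to an error `ε / (1 - α)` in the discounted reward.
Near-optimal actions and near-worst disturbance laws can be chosen measurably from countable lists
(`exists_measurable_selector`). Hence a stationary deterministic controller secures almost `u`
against every history-dependent adversary, and a stationary adversary holds every controller down to
almost `u`. Both lie in the smallest classes and are tested against the largest, so all nine max-min
values coincide with `u`. -/

theorem abs_integral_le_of_abs_le {Ω : Type*} [MeasurableSpace Ω] {μ : Measure Ω}
    [IsProbabilityMeasure μ] {g : Ω → ℝ} {C : ℝ} (h : ∀ ω, |g ω| ≤ C) : |∫ ω, g ω ∂μ| ≤ C := by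
  simpa using norm_integral_le_of_norm_le_const (μ := μ) (f := g) (Filter.Eventually.of_forall h)

section RealBounds

variable {ι : Type*} [Nonempty ι] {a b : ι → ℝ} {c : ℝ}

theorem abs_ciInf_sub_ciInf_le (ha : BddBelow (Set.range a)) (hb : BddBelow (Set.range b))
    (h : ∀ i, |a i - b i| ≤ c) : |(⨅ i, a i) - ⨅ i, b i| ≤ c := by
  have h₁ : (⨅ i, a i) - c ≤ ⨅ i, b i := le_ciInf fun i => by
    have := ciInf_le ha i
    have := (abs_le.1 (h i)).2
    linarith
  have h₂ : (⨅ i, b i) - c ≤ ⨅ i, a i := le_ciInf fun i => by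
    have := ciInf_le hb i
    have := (abs_le.1 (h i)).1
    linarith
  exact abs_le.2 ⟨by linarith, by linarith⟩

theorem abs_ciSup_sub_ciSup_le (ha : BddAbove (Set.range a)) (hb : BddAbove (Set.range b))
    (h : ∀ i, |a i - b i| ≤ c) : |(⨆ i, a i) - ⨆ i, b i| ≤ c := by
  have h₁ : (⨆ i, a i) ≤ (⨆ i, b i) + c := ciSup_le fun i => by
    have := le_ciSup hb i
    have := (abs_le.1 (h i)).2
    linarith
  have h₂ : (⨆ i, b i) ≤ (⨆ i, a i) + c := ciSup_le fun i => by
    have := le_ciSup ha i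
    have := (abs_le.1 (h i)).1
    linarith
  exact abs_le.2 ⟨by linarith, by linarith⟩

end RealBounds

/-! ### The Bellman operator: bounds, contraction, fixed point. -/

section Bellman

variable {X A W : Type*}
  [MetricSpace X] [SecondCountableTopology X] [MeasurableSpace X] [BorelSpace X]
  [MetricSpace A] [SecondCountableTopology A] [MeasurableSpace A] [BorelSpace A]
  [MetricSpace W] [SecondCountableTopology W] [MeasurableSpace W] [BorelSpace W]
  {f : X × A × W → X} {r : X × A → ℝ} {α C : ℝ}
  {Q : Set (ProbabilityMeasure A)} {P : Set (ProbabilityMeasure W)}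

theorem integrable_transition (hf : Continuous f) (u : X →ᵇ ℝ) (ψ : ProbabilityMeasure W)
    (x : X) (a : A) : Integrable (fun w => u (f (x, a, w))) (ψ : Measure W) :=
  Integrable.of_bound (by fun_prop) ‖u‖
    (Filter.Eventually.of_forall fun _ => u.norm_coe_le_norm _)

theorem abs_integral_transition_le (f : X × A × W → X) (u : X →ᵇ ℝ) (ψ : ProbabilityMeasure W)
    (x : X) (a : A) : |∫ w, u (f (x, a, w)) ∂(ψ : Measure W)| ≤ ‖u‖ :=
  abs_integral_le_of_abs_le fun _ => u.norm_coe_le_norm _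

theorem bddBelow_integral_transition (f : X × A × W → X) (P : Set (ProbabilityMeasure W))
    (u : X →ᵇ ℝ) (x : X) (a : A) :
    BddBelow (Set.range fun ψ : P => ∫ w, u (f (x, a, w)) ∂(ψ.1 : Measure W)) :=
  ⟨-‖u‖, by rintro _ ⟨ψ, rfl⟩; exact (abs_le.1 (abs_integral_transition_le f u ψ.1 x a)).1⟩

theorem continuous_integral_transition (hf : Continuous f) (u : X →ᵇ ℝ)
    (ψ : ProbabilityMeasure W) :
    Continuous fun z : X × A => ∫ w, u (f (z.1, z.2, w)) ∂(ψ : Measure W) :=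
  continuous_of_dominated (bound := fun _ => ‖u‖) (fun _ => by fun_prop)
    (fun _ => Filter.Eventually.of_forall fun _ => u.norm_coe_le_norm _) (integrable_const _)
    (Filter.Eventually.of_forall fun _ => by fun_prop)

/-- An infimum of continuous functions is upper semicontinuous, hence Borel even when `P` is
uncountable. -/
theorem measurable_robustQ (hf : Continuous f) (hr : Continuous r) (u : X →ᵇ ℝ) :
    Measurable fun z : X × A => robustQ f r α P u z.1 z.2 := by
  have h : UpperSemicontinuous fun z : X × A =>
      ⨅ ψ : P, ∫ w, u (f (z.1, z.2, w)) ∂(ψ.1 : Measure W) :=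
    upperSemicontinuous_ciInf (fun z => bddBelow_integral_transition f P u z.1 z.2)
      fun ψ => (continuous_integral_transition hf u ψ.1).upperSemicontinuous
  exact hr.measurable.add (h.measurable.const_mul α)

theorem robustQ_le (hα : 0 ≤ α) (u : X →ᵇ ℝ) {ψ : ProbabilityMeasure W} (hψ : ψ ∈ P) (x : X)
    (a : A) : robustQ f r α P u x a ≤ r (x, a) + α * ∫ w, u (f (x, a, w)) ∂(ψ : Measure W) := by
  unfold robustQ
  gcongr
  exact ciInf_le (bddBelow_integral_transition f P u x a) ⟨ψ, hψ⟩

theorem abs_robustQ_le (hP : P.Nonempty) (hα : 0 ≤ α) (hC : ∀ z, |r z| ≤ C) (u : X →ᵇ ℝ) (x : X)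
    (a : A) : |robustQ f r α P u x a| ≤ C + α * ‖u‖ := by
  have : Nonempty P := hP.to_subtype
  have h : |⨅ ψ : P, ∫ w, u (f (x, a, w)) ∂(ψ.1 : Measure W)| ≤ ‖u‖ := by
    simpa using abs_ciInf_sub_ciInf_le (b := fun _ : P => (0 : ℝ))
      (bddBelow_integral_transition f P u x a) ⟨0, by rintro _ ⟨_, rfl⟩; rfl⟩
      fun ψ => by simpa using abs_integral_transition_le f u ψ.1 x a
  calc _ ≤ |r (x, a)| + |α * _| := abs_add_le _ _
    _ ≤ C + α * ‖u‖ := by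
      rw [abs_mul, abs_of_nonneg hα]
      exact add_le_add (hC _) (mul_le_mul_of_nonneg_left h hα)

theorem bddAbove_robustQ (hP : P.Nonempty) (hα : 0 ≤ α) (hC : ∀ z, |r z| ≤ C) (u : X →ᵇ ℝ)
    (x : X) : BddAbove (Set.range fun a => robustQ f r α P u x a) :=
  ⟨C + α * ‖u‖, by rintro _ ⟨a, rfl⟩; exact (abs_le.1 (abs_robustQ_le hP hα hC u x a)).2⟩

theorem robustQ_le_bellman (hP : P.Nonempty) (hα : 0 ≤ α) (hC : ∀ z, |r z| ≤ C) (u : X →ᵇ ℝ)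
    (x : X) (a : A) : robustQ f r α P u x a ≤ bellman f r α P u x :=
  le_ciSup (bddAbove_robustQ hP hα hC u x) a

theorem abs_bellman_le [Nonempty A] (hP : P.Nonempty) (hα : 0 ≤ α) (hC : ∀ z, |r z| ≤ C)
    (u : X →ᵇ ℝ) (x : X) : |bellman f r α P u x| ≤ C + α * ‖u‖ := by
  simpa [bellman] using abs_ciSup_sub_ciSup_le (b := fun _ : A => (0 : ℝ))
    (bddAbove_robustQ hP hα hC u x) ⟨0, by rintro _ ⟨_, rfl⟩; rfl⟩
    fun a => by simpa using abs_robustQ_le (f := f) hP hα hC u x a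

theorem integral_robustQ_le_bellman (hf : Continuous f) (hr : Continuous r) (hP : P.Nonempty)
    (hα : 0 ≤ α) (hC : ∀ z, |r z| ≤ C) (u : X →ᵇ ℝ) (x : X) (φ : Measure A)
    [IsProbabilityMeasure φ] : ∫ a, robustQ f r α P u x a ∂φ ≤ bellman f r α P u x := by
  have hint : Integrable (fun a => robustQ f r α P u x a) φ :=
    Integrable.of_bound
      ((measurable_robustQ hf hr u).comp measurable_prodMk_left).aestronglyMeasurable
      (C + α * ‖u‖) (Filter.Eventually.of_forall fun a => abs_robustQ_le hP hα hC u x a)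
  simpa using integral_mono hint (integrable_const (bellman f r α P u x))
    fun a => robustQ_le_bellman hP hα hC u x a

/-- An average never exceeds the supremum, and Dirac measures recover every pure action. -/
theorem bellmanRandomized_eq_bellman [Nonempty A] (hf : Continuous f) (hr : Continuous r)
    (hQ : ∀ a : A, diracProba a ∈ Q) (hP : P.Nonempty) (hα : 0 ≤ α) (hC : ∀ z, |r z| ≤ C)
    (u : X →ᵇ ℝ) (x : X) : bellmanRandomized f r α Q P u x = bellman f r α P u x := by
  have : Nonempty Q := ⟨⟨_, hQ (Classical.arbitrary A)⟩⟩
  have hle (φ : Q) := integral_robustQ_le_bellman hf hr hP hα hC u x (φ.1 : Measure A)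
  refine le_antisymm (ciSup_le hle) (ciSup_le fun a => ?_)
  have h := le_ciSup (f := fun φ : Q => ∫ a, robustQ f r α P u x a ∂(φ.1 : Measure A))
    ⟨_, by rintro _ ⟨φ, rfl⟩; exact hle φ⟩ ⟨_, hQ a⟩
  rwa [show ((diracProba a : ProbabilityMeasure A) : Measure A) = Measure.dirac a from rfl,
    integral_dirac] at h

theorem abs_bellman_sub_bellman_le [Nonempty A] (hf : Continuous f) (hP : P.Nonempty) (hα : 0 ≤ α)
    (hC : ∀ z, |r z| ≤ C) (u v : X →ᵇ ℝ) (x : X) :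
    |bellman f r α P u x - bellman f r α P v x| ≤ α * dist u v := by
  have : Nonempty P := hP.to_subtype
  refine abs_ciSup_sub_ciSup_le (bddAbove_robustQ hP hα hC u x) (bddAbove_robustQ hP hα hC v x)
    fun a => ?_
  rw [robustQ, robustQ, add_sub_add_left_eq_sub, ← mul_sub, abs_mul, abs_of_nonneg hα]
  refine mul_le_mul_of_nonneg_left (abs_ciInf_sub_ciInf_le (bddBelow_integral_transition f P u x a)
    (bddBelow_integral_transition f P v x a) fun ψ => ?_) hα
  rw [← integral_sub (integrable_transition hf u ψ.1 x a) (integrable_transition hf v ψ.1 x a)]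
  exact abs_integral_le_of_abs_le fun w => u.dist_coe_le_dist (g := v) (f (x, a, w))

theorem bellman_fixed_point_unique [Nonempty A] (hf : Continuous f) (hP : P.Nonempty) (hα : 0 ≤ α)
    (hα1 : α < 1) (hC : ∀ z, |r z| ≤ C) {u v : X →ᵇ ℝ} (hu : ∀ x, u x = bellman f r α P u x)
    (hv : ∀ x, v x = bellman f r α P v x) : v = u := by
  have h : dist v u ≤ α * dist v u := by
    rw [BoundedContinuousFunction.dist_le (by positivity)]
    intro x
    rw [hu x, hv x]
    exact abs_bellman_sub_bellman_le hf hP hα hC v u x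
  exact dist_le_zero.1 (by nlinarith [dist_nonneg (x := v) (y := u)])

/-- Moving `(x, a)` with `w` fixed changes `u (f (x, a, w))` by an amount controlled uniformly in
`w`. The bound therefore survives integration against any `ψ` and then the infimum over `ψ`. -/
theorem uniformContinuous_robustQ (hf : UniformContinuous f) (hr : UniformContinuous r)
    (hP : P.Nonempty) {u : X →ᵇ ℝ} (hu : UniformContinuous u) :
    UniformContinuous fun z : X × A => robustQ f r α P u z.1 z.2 := by
  have : Nonempty P := hP.to_subtype
  refine UniformContinuous.add hr (UniformContinuous.const_mul' ?_ α)
  rw [Metric.uniformContinuous_iff]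
  intro ε hε
  obtain ⟨δ, hδ, h⟩ := Metric.uniformContinuous_iff.1 (hu.comp hf) (ε / 2) (half_pos hε)
  refine ⟨δ, hδ, fun {z z'} hz => lt_of_le_of_lt (abs_ciInf_sub_ciInf_le
    (bddBelow_integral_transition f P u z.1 z.2) (bddBelow_integral_transition f P u z'.1 z'.2)
    fun ψ => ?_) (half_lt_self hε)⟩
  rw [← integral_sub (integrable_transition hf.continuous u ψ.1 _ _)
    (integrable_transition hf.continuous u ψ.1 _ _)]
  exact abs_integral_le_of_abs_le fun w => (h (a := (z.1, z.2, w)) (b := (z'.1, z'.2, w)) (by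
    simpa [Prod.dist_eq, hδ] using hz)).le

theorem uniformContinuous_bellman [Nonempty A] (hf : UniformContinuous f)
    (hr : UniformContinuous r) (hP : P.Nonempty) (hα : 0 ≤ α) (hC : ∀ z, |r z| ≤ C) {u : X →ᵇ ℝ}
    (hu : UniformContinuous u) : UniformContinuous (bellman f r α P u) := by
  rw [Metric.uniformContinuous_iff]
  intro ε hε
  obtain ⟨δ, hδ, h⟩ := Metric.uniformContinuous_iff.1
    (uniformContinuous_robustQ (α := α) hf hr hP hu) (ε / 2) (half_pos hε)
  refine ⟨δ, hδ, fun {x x'} hx => lt_of_le_of_lt (abs_ciSup_sub_ciSup_le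
    (bddAbove_robustQ hP hα hC u x) (bddAbove_robustQ hP hα hC u x')
    fun a => ?_) (half_lt_self hε)⟩
  exact (h (a := (x, a)) (b := (x', a)) (by simpa [Prod.dist_eq, hδ] using hx)).le

/-- The contraction is run on uniformly continuous functions, where the operator is known to return
continuous ones; this set is closed under uniform limits, hence complete. -/
theorem exists_bellman_fixed_point [Nonempty A] (hf : UniformContinuous f)
    (hr : UniformContinuous r) (hP : P.Nonempty) (hα : 0 ≤ α) (hα1 : α < 1)
    (hC : ∀ z, |r z| ≤ C) :
    ∃ u : X →ᵇ ℝ, UniformContinuous u ∧ ∀ x, u x = bellman f r α P u x := by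
  let S : Set (X →ᵇ ℝ) := {u | UniformContinuous u}
  have hS : IsClosed S := by
    refine isClosed_of_closure_subset fun u hu => ?_
    obtain ⟨F, hF, hFu⟩ := mem_closure_iff_seq_limit.1 hu
    exact (BoundedContinuousFunction.tendsto_iff_tendstoUniformly.1 hFu).uniformContinuous
      (Filter.Frequently.of_forall hF)
  have : CompleteSpace S := hS.completeSpace_coe
  have : Nonempty S := ⟨⟨0, uniformContinuous_const⟩⟩
  let T : S → S := fun u =>
    ⟨BoundedContinuousFunction.ofNormedAddCommGroup (bellman f r α P u.1)
      (uniformContinuous_bellman hf hr hP hα hC u.2).continuous (C + α * ‖u.1‖)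
      (abs_bellman_le hP hα hC u.1), uniformContinuous_bellman hf hr hP hα hC u.2⟩
  have hT : ContractingWith ⟨α, hα⟩ T := by
    refine ⟨by exact_mod_cast hα1, LipschitzWith.of_dist_le_mul fun u v => ?_⟩
    change dist (T u).1 (T v).1 ≤ α * dist u.1 v.1
    rw [BoundedContinuousFunction.dist_le (by positivity)]
    exact fun x => abs_bellman_sub_bellman_le hf.continuous hP hα hC u.1 v.1 x
  refine ⟨_, (hT.fixedPoint T).2, fun x => ?_⟩
  exact (DFunLike.congr_fun (congrArg Subtype.val hT.fixedPoint_isFixedPt) x).symm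

end Bellman

/-! ### Marginals and disintegration of the trajectory measure. -/

theorem _root_.ProbabilityTheory.Kernel.map_eval_zero_trajMeasure {Y : ℕ → Type*}
    [∀ n, MeasurableSpace (Y n)]
    (κ : (n : ℕ) → Kernel (Π i : Finset.Iic n, Y i) (Y (n + 1))) [∀ n, IsMarkovKernel (κ n)]
    (μ₀ : Measure (Y 0)) [IsProbabilityMeasure μ₀] :
    (Kernel.trajMeasure μ₀ κ).map (fun ω => ω 0) = μ₀ := by
  have h : (fun ω : Π n, Y n => ω 0) =
      (fun e : Π i : Finset.Iic 0, Y i => e ⟨0, by simp⟩) ∘ Preorder.frestrictLe 0 := rfl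
  rw [h, ← Measure.map_map (by fun_prop) (by fun_prop), Kernel.trajMeasure,
    Measure.map_comp _ _ (by fun_prop), Kernel.traj_map_frestrictLe, Kernel.partialTraj_self,
    Measure.id_comp]
  exact (MeasurableEquiv.piUnique fun i : Finset.Iic 0 => Y i).map_map_symm

/-- If a conditional law depends on the past only through `g`, it is also the conditional law given
`g`. This passes from the raw past to the history. -/
theorem _root_.MeasureTheory.Measure.map_compProd_comap {α β γ : Type*} [MeasurableSpace α]
    [MeasurableSpace β] [MeasurableSpace γ] (μ : Measure α) [SFinite μ] (κ : Kernel β γ)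
    [IsSFiniteKernel κ] {g : α → β} (hg : Measurable g) :
    (μ ⊗ₘ κ.comap g hg).map (Prod.map g id) = μ.map g ⊗ₘ κ := by
  ext s hs
  rw [Measure.map_apply (hg.prodMap measurable_id) hs,
    Measure.compProd_apply (hg.prodMap measurable_id hs), Measure.compProd_apply hs,
    lintegral_map (Kernel.measurable_kernel_prodMk_left hs) hg]
  rfl

section History

variable {X A W : Type*}

theorem state_congr (f : X × A × W → X) (x : X) {ω ω' : ℕ → A × W} {n : ℕ}
    (h : ∀ k < n, ω k = ω' k) : state f x ω n = state f x ω' n := by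
  induction n with
  | zero => rfl
  | succ n ih =>
    rw [state, state, ih fun k hk => h k (hk.trans n.lt_succ_self), h n n.lt_succ_self]

/-- The history at time `n + 1` involves only the terms of `ω` with index at most `n`, so the
padding in `extend` is invisible. -/
theorem history_extend (f : X × A × W → X) (x : X) (n : ℕ) (ω : ℕ → A × W) :
    history f x (n + 1) (extend (Preorder.frestrictLe n ω)) = history f x (n + 1) ω := by
  have h (k : ℕ) (hk : k < n + 1) : extend (Preorder.frestrictLe n ω) k = ω k := by
    simp [extend, Nat.min_eq_left (Nat.lt_succ_iff.1 hk)]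
  refine Prod.ext (funext fun k => state_congr f x fun j hj => h j (by lia)) (funext fun k => ?_)
  exact congrArg Prod.fst (h k k.2)

end History

/-! ### One-step conditioning and the verification inequalities. -/

section Path

variable {X A W : Type*} [MeasurableSpace X] [MeasurableSpace A] [MeasurableSpace W]

theorem measurable_current {t : ℕ} : Measurable (Hist.current : Hist X A t → X) :=
  (measurable_pi_apply (Fin.last t)).comp measurable_fst

variable {f : X × A × W → X} (hf : Measurable f) (x : X) (π : ControlPolicy X A)
  (γ : AdversaryPolicy X A W)

instance : IsProbabilityMeasure (pathMeasure hf x π γ) := by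
  unfold pathMeasure; infer_instance

/-- The defining property of the path law in terms of histories: given `H_n`, the pair `(A_n, W_n)`
is drawn from the two policies' decisions at time `n`. -/
theorem map_history_pathMeasure (n : ℕ) :
    (pathMeasure hf x π γ).map (fun ω => (history f x n ω, ω n)) =
      (pathMeasure hf x π γ).map (history f x n) ⊗ₘ (π.decision n ⊗ₖ γ.decision n) := by
  cases n with
  | zero =>
    -- The initial history is deterministic, so its law is a Dirac mass.
    have h0 : (history f x 0 : (ℕ → A × W) → Hist X A 0) = fun _ => (fun _ => x, Fin.elim0) := by
      funext ω
      refine Prod.ext (funext fun k => ?_) (funext fun k => k.elim0)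
      simp [history, state]
    have h1 : (fun ω : ℕ → A × W => (history f x 0 ω, ω 0)) =
        Prod.mk ((fun _ => x, Fin.elim0) : Hist X A 0) ∘ fun ω => ω 0 := by
      rw [h0]; rfl
    rw [h1, ← Measure.map_map (by fun_prop) (by fun_prop), h0, Measure.map_const,
      measure_univ, one_smul]
    rw [pathMeasure, Kernel.map_eval_zero_trajMeasure]
    ext s hs
    rw [Measure.map_apply measurable_prodMk_left hs, Measure.compProd_apply hs,
      lintegral_dirac' _ (Kernel.measurable_kernel_prodMk_left hs)]
  | succ n =>
    have hg : Measurable fun e : Finset.Iic n → A × W => history f x (n + 1) (extend e) :=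
      (measurable_history hf x (n + 1)).comp measurable_extend
    have h : (fun ω : ℕ → A × W => (history f x (n + 1) ω, ω (n + 1))) =
        Prod.map (fun e => history f x (n + 1) (extend e)) id ∘
          fun ω => (Preorder.frestrictLe n ω, ω (n + 1)) := by
      funext ω
      simp [history_extend]
    have h' : (history f x (n + 1) : (ℕ → A × W) → Hist X A (n + 1)) =
        (fun e => history f x (n + 1) (extend e)) ∘ Preorder.frestrictLe n := by
      funext ω
      simp [history_extend]
    have hmap : (pathMeasure hf x π γ).map (history f x (n + 1)) =
        ((pathMeasure hf x π γ).map (Preorder.frestrictLe n)).map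
          fun e => history f x (n + 1) (extend e) := by
      rw [Measure.map_map hg (by fun_prop), ← h']
    rw [hmap, h, ← Measure.map_map (hg.prodMap measurable_id) (by fun_prop),
      ← Measure.map_compProd_comap _ _ hg, pathMeasure,
      ← Kernel.map_frestrictLe_trajMeasure_compProd_eq_map_trajMeasure]
    rfl

theorem integral_pathMeasure_step (n : ℕ) {g : Hist X A n × (A × W) → ℝ} (hg : Measurable g)
    {C : ℝ} (hC : ∀ z, |g z| ≤ C) :
    ∫ ω, g (history f x n ω, ω n) ∂pathMeasure hf x π γ =
      ∫ ω, ∫ p, g (history f x n ω, p) ∂(π.decision n ⊗ₖ γ.decision n) (history f x n ω)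
        ∂pathMeasure hf x π γ := by
  have hm : Measurable fun ω : ℕ → A × W => (history f x n ω, ω n) :=
    (measurable_history hf x n).prodMk (measurable_pi_apply n)
  have hh : IsProbabilityMeasure ((pathMeasure hf x π γ).map (history f x n)) :=
    Measure.isProbabilityMeasure_map (measurable_history hf x n).aemeasurable
  have hint : Integrable g
      ((pathMeasure hf x π γ).map (history f x n) ⊗ₘ (π.decision n ⊗ₖ γ.decision n)) :=
    Integrable.of_bound hg.aestronglyMeasurable C (Filter.Eventually.of_forall hC)
  rw [← integral_map hm.aemeasurable hg.aestronglyMeasurable, map_history_pathMeasure,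
    Measure.integral_compProd hint, integral_map (measurable_history hf x n).aemeasurable]
  exact (hg.stronglyMeasurable.integral_kernel_prod_right').aestronglyMeasurable

theorem integrable_pathMeasure_step (n : ℕ) {g : Hist X A n × (A × W) → ℝ} (hg : Measurable g)
    {C : ℝ} (hC : ∀ z, |g z| ≤ C) :
    Integrable (fun ω => ∫ p, g (history f x n ω, p)
      ∂(π.decision n ⊗ₖ γ.decision n) (history f x n ω)) (pathMeasure hf x π γ) :=
  Integrable.of_bound ((hg.stronglyMeasurable.integral_kernel_prod_right'
      (κ := π.decision n ⊗ₖ γ.decision n)).comp_measurable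
        (measurable_history hf x n)).aestronglyMeasurable C
    (Filter.Eventually.of_forall fun _ => abs_integral_le_of_abs_le fun _ => hC _)

/-- Taking expectations in `hstep` gives `U n - ε ≤ R n + α * U (n + 1)`. Weighting by `α ^ n` and
summing telescopes; the remainder `α ^ n * U n` vanishes since `u` is bounded, and the errors add up
to the geometric series `ε / (1 - α)`. -/
theorem le_value {r : X × A → ℝ} (hr : Measurable r) {C : ℝ} (hC : ∀ z, |r z| ≤ C) {α : ℝ}
    (hα : 0 ≤ α) (hα1 : α < 1) {u : X → ℝ} (hu : Measurable u) {D : ℝ} (hD : ∀ y, |u y| ≤ D)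
    {ε : ℝ}
    (hstep : ∀ n (h : Hist X A n), u h.current - ε ≤
      ∫ p, (r (h.current, p.1) + α * u (f (h.current, p.1, p.2)))
        ∂(π.decision n ⊗ₖ γ.decision n) h) :
    u x - ε / (1 - α) ≤ value hf r α π γ x := by
  set μ := pathMeasure hf x π γ
  set R : ℕ → ℝ := fun n => ∫ ω, r (state f x ω n, (ω n).1) ∂μ
  set U : ℕ → ℝ := fun n => ∫ ω, u (state f x ω n) ∂μ
  have hs (n : ℕ) := measurable_state (A := A) (W := W) hf x n
  have hrm (n : ℕ) : Measurable fun ω : ℕ → A × W => r (state f x ω n, (ω n).1) :=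
    hr.comp ((hs n).prodMk (measurable_pi_apply n).fst)
  have hri (n : ℕ) : Integrable (fun ω => r (state f x ω n, (ω n).1)) μ :=
    Integrable.of_bound (hrm n).aestronglyMeasurable C (Filter.Eventually.of_forall fun _ => hC _)
  have hui (n : ℕ) : Integrable (fun ω => u (state f x ω n)) μ :=
    Integrable.of_bound (hu.comp (hs n)).aestronglyMeasurable D
      (Filter.Eventually.of_forall fun _ => hD _)
  have hUb (n : ℕ) : |U n| ≤ D :=
    abs_integral_le_of_abs_le fun _ => hD _
  have hRU (n : ℕ) : U n - ε ≤ R n + α * U (n + 1) := by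
    let g : Hist X A n × (A × W) → ℝ := fun z =>
      r (z.1.current, z.2.1) + α * u (f (z.1.current, z.2.1, z.2.2))
    have hg : Measurable g := by
      have := measurable_current (X := X) (A := A) (t := n)
      fun_prop
    have hgC (z) : |g z| ≤ C + |α| * D :=
      (abs_add_le _ _).trans (add_le_add (hC _) (by
        rw [abs_mul]; exact mul_le_mul_of_nonneg_left (hD _) (abs_nonneg _)))
    have h1 := integral_pathMeasure_step hf x π γ n hg hgC
    have h2 : ∫ ω, (r (state f x ω n, (ω n).1) + α * u (state f x ω (n + 1))) ∂μ =
        R n + α * U (n + 1) := by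
      rw [integral_add (hri n) ((hui (n + 1)).const_mul α), integral_const_mul]
    have h3 : ∫ ω, (u (state f x ω n) - ε) ∂μ = U n - ε := by
      rw [integral_sub (hui n) (integrable_const ε)]
      simp [U]
    rw [← h2, ← h3]
    refine le_trans ?_ h1.ge
    refine integral_mono ((hui n).sub (integrable_const ε))
      (integrable_pathMeasure_step hf x π γ n hg hgC) fun ω => hstep n (history f x n ω)
  -- Sum and expectation are exchanged by domination with `C * α ^ n`.
  have hsum : HasSum (fun n => α ^ n * R n) (value hf r α π γ x) := by
    have hg := summable_geometric_of_lt_one hα hα1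
    have h := hasSum_integral_of_summable_integral_norm (μ := μ)
      (F := fun n ω => α ^ n * r (state f x ω n, (ω n).1)) (fun n => (hri n).const_mul _)
      (Summable.of_nonneg_of_le (fun n => by positivity) (fun n => ?_) (hg.mul_right C))
    · simp only [integral_const_mul] at h
      exact h
    · refine (le_abs_self _).trans (abs_integral_le_of_abs_le fun ω => ?_)
      rw [abs_of_nonneg (norm_nonneg _), Real.norm_eq_abs, abs_mul, abs_of_nonneg (by positivity)]
      exact mul_le_mul_of_nonneg_left (hC _) (by positivity)
  have hpart (n : ℕ) : u x - ε * ∑ k ∈ Finset.range n, α ^ k ≤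
      ∑ k ∈ Finset.range n, α ^ k * R k + α ^ n * U n := by
    induction n with
    | zero => simp [U, state]
    | succ n ih =>
      rw [Finset.sum_range_succ, Finset.sum_range_succ, pow_succ]
      have := mul_le_mul_of_nonneg_left (hRU n) (pow_nonneg hα n)
      linarith
  have hU0 : Filter.Tendsto (fun n => α ^ n * U n) Filter.atTop (nhds 0) := by
    have h := (tendsto_pow_atTop_nhds_zero_of_lt_one hα hα1).mul_const D
    rw [zero_mul] at h
    refine squeeze_zero_norm (fun n => ?_) h
    rw [Real.norm_eq_abs, abs_mul, abs_of_nonneg (by positivity)]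
    exact mul_le_mul_of_nonneg_left (hUb n) (by positivity)
  have hgeom : Filter.Tendsto (fun n => u x - ε * ∑ k ∈ Finset.range n, α ^ k) Filter.atTop
      (nhds (u x - ε / (1 - α))) := by
    rw [div_eq_mul_inv]
    exact ((hasSum_geometric_of_lt_one hα hα1).tendsto_sum_nat.const_mul ε).const_sub _
  simpa using le_of_tendsto_of_tendsto' hgeom (hsum.tendsto_sum_nat.add hU0) hpart

theorem value_le {r : X × A → ℝ} (hr : Measurable r) {C : ℝ} (hC : ∀ z, |r z| ≤ C) {α : ℝ}
    (hα : 0 ≤ α) (hα1 : α < 1) {u : X → ℝ} (hu : Measurable u) {D : ℝ} (hD : ∀ y, |u y| ≤ D)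
    {ε : ℝ}
    (hstep : ∀ n (h : Hist X A n),
      ∫ p, (r (h.current, p.1) + α * u (f (h.current, p.1, p.2)))
        ∂(π.decision n ⊗ₖ γ.decision n) h ≤ u h.current + ε) :
    value hf r α π γ x ≤ u x + ε / (1 - α) := by
  -- Apply the lower bound to `-r` and `-u`.
  have h := le_value hf x π γ (r := fun z => -r z) hr.neg (by simpa using hC) hα hα1
    (u := fun y => -u y) hu.neg (by simpa using hD) fun n h => by
      have := hstep n h
      simp only [mul_neg, ← neg_add, integral_neg]
      linarith
  simp only [value, mul_neg, tsum_neg, integral_neg] at h ⊢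
  linarith

end Path

/-- By the Lindelöf property countably many of the open sets already cover `Z`; choosing the least
index that works is measurable. No measurable structure on `ι` is needed. -/
theorem exists_measurable_selector {Z ι : Type*} [TopologicalSpace Z] [SecondCountableTopology Z]
    [MeasurableSpace Z] [OpensMeasurableSpace Z] [Nonempty ι] {U : ι → Set Z}
    (hU : ∀ i, IsOpen (U i)) (hcover : ∀ z, ∃ i, z ∈ U i) :
    ∃ (s : ℕ → ι) (N : Z → ℕ), Measurable N ∧ ∀ z, z ∈ U (s (N z)) := by
  classical
  obtain ⟨T, hT, hTU⟩ := TopologicalSpace.isOpen_iUnion_countable U hU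
  obtain ⟨s, hs⟩ := Set.countable_iff_exists_subset_range.1 hT
  have h (z : Z) : ∃ n, z ∈ U (s n) := by
    have hz : z ∈ ⋃ i ∈ T, U i := hTU ▸ Set.mem_iUnion.2 (hcover z)
    obtain ⟨i, hi, hzi⟩ := Set.mem_iUnion₂.1 hz
    obtain ⟨n, rfl⟩ := hs hi
    exact ⟨n, hzi⟩
  exact ⟨s, fun z => Nat.find (h z), measurable_find h fun n => (hU (s n)).measurableSet,
    fun z => Nat.find_spec (h z)⟩

/-! ### Stationary policies and inclusions between policy classes. -/

section Stationary

variable {X A W : Type*} [MeasurableSpace X] [MeasurableSpace A] [MeasurableSpace W]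

/-- The stationary controller's policy that plays the action `g x` in the state `x`. -/
noncomputable def ControlPolicy.ofFun {g : X → A} (hg : Measurable g) : ControlPolicy X A where
  decision _ := Kernel.deterministic (fun h => g h.current) (hg.comp measurable_current)
  isMarkovKernel _ := inferInstance

theorem ControlPolicy.ofFun_mem {g : X → A} (hg : Measurable g) {Q : Set (ProbabilityMeasure A)}
    (hQ : ∀ a, diracProba a ∈ Q) : ControlPolicy.ofFun hg ∈ controlClass X Q .S := by
  have h (t : ℕ) (h : Hist X A t) :
      (ControlPolicy.ofFun hg).law t h = diracProba (g h.current) :=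
    Subtype.ext (Kernel.deterministic_apply (hg.comp measurable_current) _)
  exact ⟨fun t k => h t k ▸ hQ _, fun t s k k' hk => by rw [h, h, hk]⟩

/-- The stationary adversary's policy with decision rule `κ`. -/
noncomputable def AdversaryPolicy.ofKernel (κ : Kernel (X × A) W) [IsMarkovKernel κ] :
    AdversaryPolicy X A W where
  decision _ := κ.comap (fun g => (g.1.current, g.2))
    ((measurable_current.comp measurable_fst).prodMk measurable_snd)
  isMarkovKernel _ := inferInstance

theorem AdversaryPolicy.ofKernel_mem (κ : Kernel (X × A) W) [IsMarkovKernel κ]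
    {P : Set (ProbabilityMeasure W)}
    (hP : ∀ z, (⟨κ z, inferInstance⟩ : ProbabilityMeasure W) ∈ P) :
    AdversaryPolicy.ofKernel κ ∈ adversaryClass X A P .S := by
  have h (t : ℕ) (g : Hist X A t × A) : (AdversaryPolicy.ofKernel κ).law t g =
      ⟨κ (g.1.current, g.2), inferInstance⟩ := rfl
  exact ⟨fun t g => h t g ▸ hP _, fun t s k k' a hk => by rw [h, h]; exact Subtype.ext (by rw [hk])⟩

theorem controlClass_stationary_subset (Q : Set (ProbabilityMeasure A)) (U : Info) :
    controlClass X Q .S ⊆ controlClass X Q U := by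
  intro π hπ
  cases U with
  | H => exact hπ.1
  | M => exact ⟨hπ.1, fun t => hπ.2 t t⟩
  | S => exact hπ

theorem adversaryClass_stationary_subset (P : Set (ProbabilityMeasure W)) (V : Info) :
    adversaryClass X A P .S ⊆ adversaryClass X A P V := by
  intro γ hγ
  cases V with
  | H => exact hγ.1
  | M => exact ⟨hγ.1, fun t => hγ.2 t t⟩
  | S => exact hγ

theorem AdversaryPolicy.law_mem {P : Set (ProbabilityMeasure W)} {V : Info}
    {γ : AdversaryPolicy X A W} (hγ : γ ∈ adversaryClass X A P V) (t : ℕ) (g : Hist X A t × A) :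
    γ.law t g ∈ P := by
  cases V with
  | H => exact hγ t g
  | M => exact hγ.1 t g
  | S => exact hγ.1 t g

end Stationary

/-- Supplies the lower bound that makes the real infimum over adversaries meaningful. -/
theorem abs_value_le {X A W : Type*} [MeasurableSpace X] [MeasurableSpace A] [MeasurableSpace W]
    {f : X × A × W → X} (hf : Measurable f) {r : X × A → ℝ} {C : ℝ} (hC : ∀ z, |r z| ≤ C) {α : ℝ}
    (hα : 0 ≤ α) (hα1 : α < 1) (π : ControlPolicy X A) (γ : AdversaryPolicy X A W) (x : X) :
    |value hf r α π γ x| ≤ C * (1 - α)⁻¹ := by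
  refine abs_integral_le_of_abs_le fun ω => ?_
  refine tsum_of_norm_bounded (f := fun t => α ^ t * r (state f x ω t, (ω t).1)) ((hasSum_geometric_of_lt_one hα hα1).mul_left C) fun t => ?_
  rw [Real.norm_eq_abs, abs_mul, abs_of_nonneg (pow_nonneg hα t), mul_comm]
  exact mul_le_mul_of_nonneg_right (hC _) (pow_nonneg hα t)

/-! ### Near-optimal stationary policies and the value. -/

section Main

variable {X A W : Type*}
  [MetricSpace X] [SecondCountableTopology X] [MeasurableSpace X] [BorelSpace X]
  [MetricSpace A] [SecondCountableTopology A] [MeasurableSpace A] [BorelSpace A]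
  [MetricSpace W] [SecondCountableTopology W] [MeasurableSpace W] [BorelSpace W]
  {f : X × A × W → X} {r : X × A → ℝ} {α C : ℝ}
  {Q : Set (ProbabilityMeasure A)} {P : Set (ProbabilityMeasure W)}

theorem integrable_integral_step (hf : Continuous f) (hr : Continuous r) (hC : ∀ z, |r z| ≤ C)
    (u : X →ᵇ ℝ) (π : ControlPolicy X A) (γ : AdversaryPolicy X A W) (n : ℕ) (h : Hist X A n) :
    Integrable (fun a => r (h.current, a) + α * ∫ w, u (f (h.current, a, w)) ∂γ.decision n (h, a))
        (π.decision n h) ∧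
      ∫ p, (r (h.current, p.1) + α * u (f (h.current, p.1, p.2)))
          ∂(π.decision n ⊗ₖ γ.decision n) h =
        ∫ a, (r (h.current, a) + α * ∫ w, u (f (h.current, a, w)) ∂γ.decision n (h, a))
          ∂π.decision n h := by
  have hint : Integrable
      (fun p : A × W => r (h.current, p.1) + α * u (f (h.current, p.1, p.2)))
      ((π.decision n ⊗ₖ γ.decision n) h) := by
    refine Integrable.of_bound (by fun_prop) (C + |α| * ‖u‖)
      (Filter.Eventually.of_forall fun p => (abs_add_le _ _).trans (add_le_add (hC _) ?_))
    rw [abs_mul]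
    exact mul_le_mul_of_nonneg_left (u.norm_coe_le_norm _) (abs_nonneg _)
  have hinner (a : A) :
      ∫ w, (r (h.current, a) + α * u (f (h.current, a, w))) ∂γ.decision n (h, a) =
        r (h.current, a) + α * ∫ w, u (f (h.current, a, w)) ∂γ.decision n (h, a) := by
    have hi : Integrable (fun w => u (f (h.current, a, w))) (γ.decision n (h, a)) :=
      integrable_transition hf u (γ.law n (h, a)) _ _
    rw [integral_add (integrable_const _) (hi.const_mul α), integral_const_mul]
    simp
  constructor
  · simpa only [hinner] using hint.integral_compProd
  · rw [integral_compProd hint]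
    simp only [hinner]

/-- For fixed `a`, the states where `a` is `ε`-optimal form an open set, and these sets cover `X`.
The selected action beats `u - ε` against each law in `P`, hence against whatever the adversary
derives from the history. -/
theorem exists_control_le_value [Nonempty A] (hf : UniformContinuous f)
    (hr : UniformContinuous r) (hQ : ∀ a, diracProba a ∈ Q) (hP : P.Nonempty) (hα : 0 ≤ α)
    (hα1 : α < 1) (hC : ∀ z, |r z| ≤ C) {u : X →ᵇ ℝ} (hu : UniformContinuous u)
    (huT : ∀ x, u x = bellman f r α P u x) {ε : ℝ} (hε : 0 < ε) :
    ∃ π ∈ controlClass X Q .S, ∀ (V : Info), ∀ γ ∈ adversaryClass X A P V, ∀ x,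
      u x - ε / (1 - α) ≤ value hf.continuous.measurable r α π γ x := by
  have hcont := (uniformContinuous_robustQ (α := α) hf hr hP hu).continuous
  obtain ⟨s, N, hN, hsel⟩ := exists_measurable_selector
    (U := fun a : A => {x : X | u x - ε < robustQ f r α P u x a})
    (fun a => isOpen_lt (by fun_prop) (hcont.comp (Continuous.prodMk_left a)))
    fun x => exists_lt_of_lt_ciSup (by
      change u x - ε < bellman f r α P u x
      rw [← huT]; linarith)
  have hg : Measurable (s ∘ N) := measurable_from_nat.comp hN
  refine ⟨_, ControlPolicy.ofFun_mem hg hQ, fun V γ hγ x => ?_⟩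
  refine le_value _ x _ γ hr.continuous.measurable hC hα hα1 u.continuous.measurable
    u.norm_coe_le_norm fun n h => ?_
  rw [(integrable_integral_step hf.continuous hr.continuous hC u _ γ n h).2]
  change _ ≤ ∫ a, _ ∂(Kernel.deterministic _ (hg.comp measurable_current) h)
  rw [Kernel.deterministic_apply, integral_dirac]
  exact (hsel h.current).le.trans (robustQ_le hα u (AdversaryPolicy.law_mem hγ n _) _ _)

/-- The law is selected as a function of `(x, a)`, so it is nearly worst for every action. No
randomization or memory of the controller helps, and no restriction on `π` is needed. -/
theorem exists_adversary_value_le (hf : UniformContinuous f)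
    (hr : UniformContinuous r) (hP : P.Nonempty) (hα : 0 ≤ α)
    (hα1 : α < 1) (hC : ∀ z, |r z| ≤ C) {u : X →ᵇ ℝ} (hu : UniformContinuous u)
    (huT : ∀ x, u x = bellman f r α P u x) {ε : ℝ} (hε : 0 < ε) :
    ∃ γ ∈ adversaryClass X A P .S, ∀ (π : ControlPolicy X A) (x : X),
      value hf.continuous.measurable r α π γ x ≤ u x + ε / (1 - α) := by
  have : Nonempty P := hP.to_subtype
  have hcont := (uniformContinuous_robustQ (α := α) hf hr hP hu).continuous
  have hcont' (ψ : P) := continuous_integral_transition hf.continuous u ψ.1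
  obtain ⟨s, N, hN, hsel⟩ := exists_measurable_selector
    (U := fun ψ : P => {z : X × A | r z + α * ∫ w, u (f (z.1, z.2, w)) ∂(ψ.1 : Measure W) <
      robustQ f r α P u z.1 z.2 + ε})
    (fun ψ => isOpen_lt (hr.continuous.add ((hcont' ψ).const_mul α)) (by fun_prop))
    fun z => by
      obtain ⟨ψ, hψ⟩ := exists_lt_of_ciInf_lt (lt_add_of_pos_right
        (⨅ ψ : P, ∫ w, u (f (z.1, z.2, w)) ∂(ψ.1 : Measure W)) hε)
      refine ⟨ψ, ?_⟩
      have := mul_le_mul_of_nonneg_left hψ.le hα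
      -- A law within `ε` of the infimum costs only `α * ε < ε` after discounting.
      have := mul_lt_mul_of_pos_right hα1 hε
      change _ < r z + α * _ + ε
      linarith
  -- Only countably many laws are used, so measurability of the kernel reduces to that of the index
  -- `N`.
  let κ : Kernel (X × A) W :=
    (Kernel.ofFunOfCountable fun n => ((s n).1 : Measure W)).comap N hN
  have : IsMarkovKernel κ := ⟨fun z => (s (N z)).1.2⟩
  refine ⟨.ofKernel κ, AdversaryPolicy.ofKernel_mem κ fun z => (s (N z)).2, fun π x => ?_⟩
  refine value_le _ x π _ hr.continuous.measurable hC hα hα1 u.continuous.measurable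
    u.norm_coe_le_norm fun n h => ?_
  obtain ⟨hint, heq⟩ := integrable_integral_step (α := α) hf.continuous hr.continuous hC u π
    (.ofKernel κ) n h
  rw [heq]
  refine (integral_mono hint (integrable_const (u h.current + ε)) fun a => ?_).trans (by simp)
  refine (hsel (h.current, a)).le.trans ?_
  rw [huT]
  exact add_le_add_left (robustQ_le_bellman hP hα hC u h.current a) ε

theorem eq_maxminValue [Nonempty A] (hf : UniformContinuous f)
    (hr : UniformContinuous r) (hQ : ∀ a, diracProba a ∈ Q) (hP : P.Nonempty) (hα : 0 ≤ α)
    (hα1 : α < 1) (hC : ∀ z, |r z| ≤ C) {u : X →ᵇ ℝ} (hu : UniformContinuous u)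
    (huT : ∀ x, u x = bellman f r α P u x) (U V : Info) (x : X) :
    u x = maxminValue hf.continuous.measurable r α (controlClass X Q U)
      (adversaryClass X A P V) x := by
  have hpos : 0 < 1 - α := by linarith
  have hbelow (π : ControlPolicy X A) : BddBelow (Set.range fun γ : adversaryClass X A P V =>
      value hf.continuous.measurable r α π γ.1 x) :=
    ⟨-(C * (1 - α)⁻¹), by
      rintro _ ⟨γ, rfl⟩; exact (abs_le.1 (abs_value_le _ hC hα hα1 π γ.1 x)).1⟩
  have hinf {ε : ℝ} (hε : 0 < ε) (π : ControlPolicy X A) :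
      ⨅ γ : adversaryClass X A P V, value hf.continuous.measurable r α π γ.1 x ≤ u x + ε := by
    -- A one-step error of `ε * (1 - α)` accumulates to exactly `ε`.
    obtain ⟨γ, hγ, h⟩ := exists_adversary_value_le hf hr hP hα hα1 hC hu huT (mul_pos hε hpos)
    rw [mul_div_cancel_right₀ ε hpos.ne'] at h
    exact (ciInf_le (hbelow π) ⟨γ, adversaryClass_stationary_subset P V hγ⟩).trans (h π x)
  have hV : Nonempty (adversaryClass X A P V) := by
    obtain ⟨γ, hγ, -⟩ := exists_adversary_value_le hf hr hP hα hα1 hC hu huT one_pos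
    exact ⟨γ, adversaryClass_stationary_subset P V hγ⟩
  have hU : Nonempty (controlClass X Q U) := by
    obtain ⟨π, hπ, -⟩ := exists_control_le_value hf hr hQ hP hα hα1 hC hu huT one_pos
    exact ⟨π, controlClass_stationary_subset Q U hπ⟩
  refine le_antisymm (le_of_forall_pos_le_add fun ε hε => ?_)
    (le_of_forall_pos_le_add fun ε hε => ciSup_le fun π => hinf hε π.1)
  obtain ⟨π, hπ, h⟩ := exists_control_le_value hf hr hQ hP hα hα1 hC hu huT (mul_pos hε hpos)
  rw [mul_div_cancel_right₀ ε hpos.ne'] at h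
  rw [← sub_le_iff_le_add]
  refine (le_ciInf fun γ : adversaryClass X A P V => h V γ.1 γ.2 x).trans ?_
  exact le_ciSup (f := fun π : controlClass X Q U => ⨅ γ : adversaryClass X A P V,
      value hf.continuous.measurable r α π.1 γ.1 x)
    -- The outer supremum is bounded above by the adversary's guarantee with total error `1`.
    ⟨u x + 1, by rintro _ ⟨π, rfl⟩; exact hinf one_pos π.1⟩
    ⟨π, controlClass_stationary_subset Q U hπ⟩

end Main

end DRSC

theorem mainTheorem8
    {X A W : Type*}
    [MetricSpace X] [CompleteSpace X] [SecondCountableTopology X] [MeasurableSpace X] [BorelSpace X]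
    [MetricSpace A] [CompleteSpace A] [SecondCountableTopology A] [MeasurableSpace A] [BorelSpace A]
    [MetricSpace W] [CompleteSpace W] [SecondCountableTopology W] [MeasurableSpace W] [BorelSpace W]
    [Nonempty A]
    (f : X × A × W → X) (hf : UniformContinuous f)
    (r : X × A → ℝ) (hr : UniformContinuous r)
    (rmax : ℝ) (hr_bound : ∀ z, 0 ≤ r z ∧ r z ≤ rmax)
    (α : ℝ) (hα0 : 0 < α) (hα1 : α < 1)
    (Q : Set (ProbabilityMeasure A)) (hQ : MeasurableSet[borel (ProbabilityMeasure A)] Q)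
    (hQ_dirac : ∀ a : A, diracProba a ∈ Q)
    (P : Set (ProbabilityMeasure W)) (hP : MeasurableSet[borel (ProbabilityMeasure W)] P)
    (hP_nonempty : P.Nonempty) :
    -- the two forms of the Bellman equation agree
    (∀ (u : X →ᵇ ℝ) (x : X),
      DRSC.bellmanRandomized f r α Q P u x = DRSC.bellman f r α P u x) ∧
    ∃ u : X →ᵇ ℝ, UniformContinuous u ∧
      -- `u` is the unique bounded continuous solution of the Bellman equation
      (∀ x, u x = DRSC.bellman f r α P u x) ∧
      (∀ v : X →ᵇ ℝ, (∀ x, v x = DRSC.bellman f r α P v x) → v = u) ∧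
      -- `u` is the value for each of the nine pairings of policy classes
      ∀ (U V : DRSC.Info) (x : X),
        u x = DRSC.maxminValue hf.continuous.measurable r α
          (DRSC.controlClass X Q U) (DRSC.adversaryClass X A P V) x := by
  have hC (z : X × A) : |r z| ≤ rmax := by
    rw [abs_of_nonneg (hr_bound z).1]
    exact (hr_bound z).2
  obtain ⟨u, hu, huT⟩ := DRSC.exists_bellman_fixed_point hf hr hP_nonempty hα0.le hα1 hC
  exact ⟨DRSC.bellmanRandomized_eq_bellman hf.continuous hr.continuous hQ_dirac hP_nonempty hα0.le hC,
    u, hu, huT,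
    fun v => DRSC.bellman_fixed_point_unique hf.continuous hP_nonempty hα0.le hα1 hC huT,
    DRSC.eq_maxminValue hf hr hQ_dirac hP_nonempty hα0.le hα1 hC hu huT⟩
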